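/- Let $n\ge 0$ be an integer. Let $K^C_{n+1}$ be the complete signed graph of type $C$ on the vertex set $\{1,\dots,n+1\}$: its edges are $(i,j,+)$ and $(i,j,-)$ for $1\le i<j\le n+1$, and the loops $(i,i,+)$ for $1\le i\le n+1$; let $E$ be its edge set. To an edge $(i,j,\pm)$ associate the vector $\mathbf v(i,j,\pm)=\mathbf e_i\pm\mathbf e_j\in\mathbb Z^{n+1}$ (so $\mathbf v(i,i,+)=2\mathbf e_i$). Let $$CRYC_{n+1}=\Big\{\, b\in\mathbb R_{\ge 0}^{E} \;:\; \sum_{e\in E} b(e)\,\mathbf v(e)=(2,0,\dots,0)\,\Big\}$$ be the flow polytope of $K^C_{n+1}$ with netflow $(2,0,\dots,0)$. For a $d$-dimensional polytope $P\subset\mathbb R^E$ with rational affine span, let $\mathrm{vol}(P)$ denote its normalized volume, i.e. $d!$ times its $d$-dimensional volume, where the volume on the affine span of $P$ is scaled so that a fundamental parallelepiped of the lattice of integer vectors parallel to that affine span has volume $1$. For a rational function $f$ in $x_1,\dots,x_{n-1}$, let $CT_{x_i}f$ denote the constant term of the Laurent expansion of $f$ in $x_i$ at $x_i=0$, the other variables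 being considered as constants. Then $$\mathrm{vol}(CRYC_{n+1}) = CT_{x_{n-1}}CT_{x_{n-2}}\cdots CT_{x_1}\ \prod_{i=1}^{n-1}x_i^{-1}(1-x_i)^{-2}(1-2x_i)^{-1}\prod_{1\le i<j\le n-1}(x_j-x_i)^{-1}(1-x_j-x_i)^{-1},$$ where $CT_{x_1}$ is applied first (for $n\le 1$ there are no variables and the right-hand side is $1$). -/

import Mathlib

open scoped Nat

/-! ### Signed graphs and their flow polytopes -/

/-- A finite signed (multi)graph with linearly ordered vertex set `V` and edges indexed by `E`.
The edge `e` is `(left e, right e, +)` if `positive e`, and `(left e, right e, -)` otherwise;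
loops are positive. -/
structure SignedGraph (V E : Type*) [LinearOrder V] where
  left : E → V
  right : E → V
  positive : E → Bool
  left_le_right : ∀ e, left e ≤ right e
  positive_of_loop : ∀ e, left e = right e → positive e = true

namespace SignedGraph

variable {V E : Type*} [LinearOrder V]

/-- The root of an edge: `e_i - e_j` for `(i, j, -)` and `e_i + e_j` for `(i, j, +)`
(so `2 e_i` for a loop at `i`). -/
def root (G : SignedGraph V E) (e : E) : V → ℤ :=
  Pi.single (G.left e) 1 +
    if G.positive e then Pi.single (G.right e) 1 else -Pi.single (G.right e) 1

/-- The matrix whose columns are the roots of the edges. -/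
def rootMatrix (G : SignedGraph V E) : Matrix V E ℤ :=
  Matrix.of fun v e => G.root e v

/-- The flow polytope: all nonnegative real flows on the edges with netflow `a`. -/
def flowPolytope [Fintype E] (G : SignedGraph V E) (a : V → ℤ) : Set (EuclideanSpace ℝ E) :=
  {b | (∀ e, 0 ≤ b e) ∧
    (G.rootMatrix.map (Int.cast : ℤ → ℝ)).mulVec (fun e => b e) = fun v => (a v : ℝ)}

end SignedGraph

/-- The edges of the complete type `C` signed graph on `Fin m`: all `(i, j, ±)` with `i < j`,
and all loops `(i, i, +)`. -/
abbrev CompleteCEdge (m : ℕ) : Type :=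
  {e : Fin m × Fin m × Bool // e.1 < e.2.1 ∨ (e.1 = e.2.1 ∧ e.2.2 = true)}

/-- The complete type `C` signed graph on `m` vertices. -/
def completeC (m : ℕ) : SignedGraph (Fin m) (CompleteCEdge m) where
  left e := e.1.1
  right e := e.1.2.1
  positive e := e.1.2.2
  left_le_right e := e.2.elim le_of_lt fun h => h.1.le
  positive_of_loop e h := e.2.elim (fun h' => absurd h h'.ne) fun h' => h'.2

/-- The polytope `CRYC_{n+1}`: the flow polytope of the complete type `C` signed graph on `n + 1`
vertices with netflow `(2, 0, …, 0)`. -/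
def CRYC (n : ℕ) : Set (EuclideanSpace ℝ (CompleteCEdge (n + 1))) :=
  (completeC (n + 1)).flowPolytope (Pi.single 0 2)

/-! ### Normalized volume -/

section NormalizedVolume

variable {ι : Type*} [Fintype ι]

/-- The integer points of the linear space parallel to the affine span of `P`. -/
noncomputable def directionLattice (P : Set (EuclideanSpace ℝ ι)) :
    Submodule ℤ (vectorSpan ℝ P) :=
  (Submodule.span ℤ (Set.range (EuclideanSpace.basisFun ι ℝ))).comap
    ((vectorSpan ℝ P).subtype.restrictScalars ℤ)

open Classical in
/-- The normalized volume of a (rational) polytope `P` of dimension `d`: `d!` times the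
`d`-dimensional volume of `P` in its affine span (identified with its direction by the choice of a
base point in `P`), in units of the covolume of the lattice of integer points.
A unimodular integer simplex of dimension `d` thus has normalized volume `1`. -/
noncomputable def normalizedVolume (P : Set (EuclideanSpace ℝ ι)) : ℝ :=
  if h : P.Nonempty then
    (Module.finrank ℝ (vectorSpan ℝ P))! *
      (MeasureTheory.volume.real {v : vectorSpan ℝ P | (v : EuclideanSpace ℝ ι) + h.some ∈ P} /
        ZLattice.covolume (directionLattice P))
  else 0

end NormalizedVolume

/-! ### Iterated constant terms of rational functions -/

/-- The field of rational functions in the variables `x_i`, `i : σ`, over `ℝ`. -/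
abbrev RatFun (σ : Type*) : Type _ := FractionRing (MvPolynomial σ ℝ)

namespace RatFun

variable {σ : Type*}

/-- The variable `x_i` as a rational function. -/
noncomputable def x (i : σ) : RatFun σ :=
  algebraMap (MvPolynomial σ ℝ) (RatFun σ) (MvPolynomial.X i)

variable [DecidableEq σ]

/-- A polynomial, seen as a polynomial in the single variable `x_i` (written `T`) whose
coefficients involve only the other variables. -/
noncomputable def asPolynomialIn (i : σ) : MvPolynomial σ ℝ →ₐ[ℝ] Polynomial (RatFun σ) :=
  MvPolynomial.aeval fun j => if j = i then Polynomial.X else Polynomial.C (x j)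

theorem asPolynomialIn_injective (i : σ) : Function.Injective (asPolynomialIn i) := by
  have h : ((Polynomial.aeval (x i)).restrictScalars ℝ).comp (asPolynomialIn i) =
      IsScalarTower.toAlgHom ℝ (MvPolynomial σ ℝ) (RatFun σ) := by
    apply MvPolynomial.algHom_ext
    intro j
    by_cases hj : j = i
    · subst hj; simp [asPolynomialIn, x]
    · simp [asPolynomialIn, x, hj]
  intro p q hpq
  apply IsFractionRing.injective (MvPolynomial σ ℝ) (RatFun σ)
  have hp := DFunLike.congr_fun h p
  have hq := DFunLike.congr_fun h q
  simp only [AlgHom.comp_apply, hpq] at hp hq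
  exact hp.symm.trans hq

/-- A polynomial, seen as a Laurent series in `x_i` over the field of rational functions. -/
noncomputable def polyToLaurent (i : σ) : MvPolynomial σ ℝ →+* LaurentSeries (RatFun σ) :=
  (algebraMap (Polynomial (RatFun σ)) (LaurentSeries (RatFun σ))).comp
    (asPolynomialIn i : MvPolynomial σ ℝ →+* Polynomial (RatFun σ))

theorem polyToLaurent_injective (i : σ) : Function.Injective (polyToLaurent i) :=
  (FaithfulSMul.algebraMap_injective (Polynomial (RatFun σ)) (LaurentSeries (RatFun σ))).comp
    (asPolynomialIn_injective i)

/-- The Laurent expansion of a rational function in the variable `x_i` at `x_i = 0`, the other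
variables being considered as constants. -/
noncomputable def laurentExpansion (i : σ) : RatFun σ →+* LaurentSeries (RatFun σ) :=
  IsFractionRing.lift (polyToLaurent_injective i)

/-- `CT_{x_i} f`, the constant term of the Laurent expansion of `f` in `x_i`. -/
noncomputable def CT (i : σ) (f : RatFun σ) : RatFun σ :=
  (laurentExpansion i f).coeff 0

/-- The iterated constant term `CT_{x_m} ⋯ CT_{x_2} CT_{x_1} f` (the first variable comes
first). -/
noncomputable def iteratedCT {m : ℕ} (f : RatFun (Fin m)) : RatFun (Fin m) :=
  (List.finRange m).foldl (fun g i => CT i g) f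

end RatFun

/-!
A flow on `completeC (n + 1)` with netflow `(2, 0, …, 0)` is determined by its values on the edges
among the last `n` vertices and on the positive edges at the first vertex, and these are lattice
coordinates. In them `CRYC n` is a cone `C` truncated by `ℓ ≤ 1`, where `ℓ` is half of the flow
leaving the first vertex for the other vertices, and `d! vol (C ∩ {ℓ ≤ 1}) = ∫_C exp (-ℓ)`.

At each remaining vertex, integrating over the positive edge to the first vertex turns `exp (-ℓ)`
into the correlation of two gamma kernels, evaluated at the netflow of the vertex. Since gamma
kernels convolve to gamma kernels, and the gamma kernel of a sum expands multinomially, the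
integral over the edges at one vertex again has this shape, with other exponents: removing the
vertices one at a time evaluates the integral by a recursion on exponents.

The constant term satisfies the same recursion. In the expansion of the kernel in `x_1`, the
factors `(1 - x_1) ^ -(b + 1)`, `(1 - 2 x_1)⁻¹`, `(1 - x_j - x_1)⁻¹` and `(x_j - x_1)⁻¹` play the
roles of the flow passing through the first vertex, its loop, its positive edges and its negative
edges.
-/

open MeasureTheory Set
open scoped ENNReal

/-! ### Gamma kernels -/

theorem lintegral_Ioi_pow_mul_exp_neg (a : ℕ) :
    ∫⁻ t in Ioi (0 : ℝ), ENNReal.ofReal (t ^ a * Real.exp (-t)) = a ! := by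
  have hGamma : ∫ t in Ioi (0 : ℝ), t ^ a * Real.exp (-t) = a ! := by
    simp [← Real.Gamma_nat_eq_factorial, Real.Gamma_eq_integral (s := a + 1) (by positivity),
      mul_comm]
  have hint : IntegrableOn (fun t : ℝ => t ^ a * Real.exp (-t)) (Ioi 0) := by
    simpa [mul_comm] using Real.GammaIntegral_convergent (s := a + 1) (by positivity)
  rw [← ofReal_integral_eq_lintegral_ofReal hint, hGamma, ENNReal.ofReal_natCast]
  filter_upwards [ae_restrict_mem measurableSet_Ioi] with t (ht : 0 < t)
  positivity

theorem setLIntegral_Ici_const_mul_pow_mul_exp_neg (a : ℕ) {c : ℝ} (hc : 0 ≤ c) :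
    ∫⁻ t in Ici (0 : ℝ), ENNReal.ofReal (c * (t ^ a * Real.exp (-t))) =
      ENNReal.ofReal (c * a !) := by
  simp_rw [ENNReal.ofReal_mul hc]
  rw [lintegral_const_mul _ (by fun_prop), setLIntegral_congr Ioi_ae_eq_Ici.symm,
    lintegral_Ioi_pow_mul_exp_neg, ENNReal.ofReal_natCast]

theorem sum_pow_div_factorial {ι K : Type*} [Fintype ι] [DecidableEq ι] [Field K] [CharZero K]
    (t : ι → K) (a : ℕ) :
    (∑ i, t i) ^ a / a ! =
      ∑ l ∈ Finset.piAntidiag Finset.univ a, ∏ i, t i ^ l i / (l i)! := by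
  rw [Finset.sum_pow_eq_sum_piAntidiag, Finset.sum_div]
  refine Finset.sum_congr rfl fun l hl => ?_
  have hspec : (∏ i, ((l i)! : K)) * Nat.multinomial Finset.univ l = a ! := by
    rw [← (Finset.mem_piAntidiag.1 hl).1]
    exact_mod_cast Nat.multinomial_spec Finset.univ l
  have hfact : ∏ i, ((l i)! : K) ≠ 0 :=
    Finset.prod_ne_zero_iff.2 fun i _ => Nat.cast_ne_zero.2 (l i).factorial_ne_zero
  have ha : (a ! : K) ≠ 0 := Nat.cast_ne_zero.2 a.factorial_ne_zero
  rw [Finset.prod_div_distrib, div_eq_div_iff ha hfact, ← hspec]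
  ring

/-- The unnormalized density of a gamma distribution of shape `a + 1`, extended by zero to the
negative half line. The rate `1 / 2` makes the pairing of two kernels a binomial coefficient. -/
noncomputable def gammaKernel (a : ℕ) : ℝ → ℝ≥0∞ :=
  (Ici 0).indicator fun t => ENNReal.ofReal (t ^ a / a ! * Real.exp (-t / 2))

theorem gammaKernel_of_nonneg (a : ℕ) {t : ℝ} (ht : 0 ≤ t) :
    gammaKernel a t = ENNReal.ofReal (t ^ a / a ! * Real.exp (-t / 2)) :=
  indicator_of_mem (mem_Ici.2 ht) _

theorem gammaKernel_of_neg (a : ℕ) {t : ℝ} (ht : t < 0) : gammaKernel a t = 0 :=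
  indicator_of_notMem (notMem_Ici.2 ht) _

@[fun_prop]
theorem measurable_gammaKernel (a : ℕ) : Measurable (gammaKernel a) :=
  Measurable.indicator (by fun_prop) measurableSet_Ici

theorem setLIntegral_Ici_gammaKernel_mul (a : ℕ) (f : ℝ → ℝ≥0∞) :
    ∫⁻ t in Ici 0, gammaKernel a t * f t = ∫⁻ t, gammaKernel a t * f t := by
  refine setLIntegral_eq_of_support_subset fun t ht => ?_
  contrapose! ht
  simp [gammaKernel_of_neg a (notMem_Ici.1 ht)]

theorem setLIntegral_Ici_gammaKernel_two_mul (a : ℕ) :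
    ∫⁻ t in Ici 0, gammaKernel a (2 * t) = 2 ^ a := by
  have hcongr : ∀ t ∈ Ici (0 : ℝ), gammaKernel a (2 * t) =
      ENNReal.ofReal (2 ^ a / a ! * (t ^ a * Real.exp (-t))) := by
    intro t ht
    rw [gammaKernel_of_nonneg a (mul_nonneg zero_le_two ht)]
    ring_nf
  rw [setLIntegral_congr_fun measurableSet_Ici hcongr,
    setLIntegral_Ici_const_mul_pow_mul_exp_neg a (by positivity),
    div_mul_cancel₀ _ (by positivity), ENNReal.ofReal_pow zero_le_two, ENNReal.ofReal_ofNat]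

theorem lintegral_gammaKernel_mul_gammaKernel (a b : ℕ) :
    ∫⁻ t, gammaKernel b t * gammaKernel a t = (a + b).choose a := by
  have hcongr : ∀ t ∈ Ici (0 : ℝ), gammaKernel b t * gammaKernel a t =
      ENNReal.ofReal (1 / (b ! * a !) * (t ^ (a + b) * Real.exp (-t))) := by
    intro t (ht : 0 ≤ t)
    rw [gammaKernel_of_nonneg b ht, gammaKernel_of_nonneg a ht,
      ← ENNReal.ofReal_mul (by positivity), show -t = -t / 2 + -t / 2 by ring, Real.exp_add]
    ring_nf
  rw [← setLIntegral_Ici_gammaKernel_mul, setLIntegral_congr_fun measurableSet_Ici hcongr,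
    setLIntegral_Ici_const_mul_pow_mul_exp_neg _ (by positivity), ← ENNReal.ofReal_natCast,
    Nat.cast_choose ℝ (Nat.le_add_right a b), Nat.add_sub_cancel_left]
  congr 1
  field_simp

theorem gammaKernel_zero_mul_gammaKernel_neg_add (a : ℕ) (x y : ℝ) :
    gammaKernel 0 y * gammaKernel a (-y + x) =
      (Icc 0 x).indicator
        (fun y => ENNReal.ofReal ((x - y) ^ a / a ! * Real.exp (-x / 2))) y := by
  rcases lt_or_ge y 0 with hy | hy
  · simp [gammaKernel_of_neg 0 hy, hy]
  rcases lt_or_ge x y with hxy | hxy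
  · simp [gammaKernel_of_neg a (show -y + x < 0 by linarith), hxy]
  rw [indicator_of_mem (mem_Icc.2 ⟨hy, hxy⟩), gammaKernel_of_nonneg 0 hy,
    gammaKernel_of_nonneg a (show 0 ≤ -y + x by linarith), ← ENNReal.ofReal_mul (by positivity),
    show -x / 2 = -y / 2 + -(-y + x) / 2 by ring, Real.exp_add]
  norm_num
  ring_nf

theorem gammaKernel_zero_lconvolution (a : ℕ) :
    gammaKernel 0 ⋆ₗ gammaKernel a = gammaKernel (a + 1) := by
  ext x
  simp_rw [lconvolution_def, gammaKernel_zero_mul_gammaKernel_neg_add]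
  rw [lintegral_indicator measurableSet_Icc]
  rcases lt_or_ge x 0 with hx | hx
  · simp [gammaKernel_of_neg _ hx, Icc_eq_empty hx.not_ge]
  have hintegral : ∫ y in Icc 0 x, (x - y) ^ a / a ! * Real.exp (-x / 2) =
      x ^ (a + 1) / (a + 1)! * Real.exp (-x / 2) := by
    rw [integral_Icc_eq_integral_Ioc, ← intervalIntegral.integral_of_le hx,
      intervalIntegral.integral_comp_sub_left (fun u => u ^ a / a ! * Real.exp (-x / 2)) x]
    simp [Nat.factorial_succ]
    field_simp
  rw [gammaKernel_of_nonneg _ hx, ← hintegral, ofReal_integral_eq_lintegral_ofReal]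
  · exact Continuous.integrableOn_Icc (by fun_prop)
  · filter_upwards [ae_restrict_mem measurableSet_Icc] with y hy
    have := sub_nonneg.2 hy.2
    positivity

theorem gammaKernel_lconvolution (a b : ℕ) :
    gammaKernel a ⋆ₗ gammaKernel b = gammaKernel (b + a + 1) := by
  induction a with
  | zero => exact gammaKernel_zero_lconvolution b
  | succ a ih =>
    rw [← gammaKernel_zero_lconvolution, ← lconvolution_assoc (by fun_prop) (by fun_prop)
      (by fun_prop), ih, gammaKernel_zero_lconvolution, ← add_assoc b]

theorem gammaKernel_sum {ι : Type*} [Fintype ι] [DecidableEq ι] (a : ℕ) {t : ι → ℝ}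
    (ht : ∀ i, 0 ≤ t i) :
    gammaKernel a (∑ i, t i) =
      ∑ l ∈ Finset.piAntidiag Finset.univ a, ∏ i, gammaKernel (l i) (t i) := by
  have hpos (l : ι → ℕ) (i : ι) : 0 ≤ t i ^ l i / (l i)! * Real.exp (-t i / 2) := by
    have := ht i
    positivity
  simp_rw [gammaKernel_of_nonneg _ (ht _), gammaKernel_of_nonneg _
    (Finset.sum_nonneg fun i _ => ht i), ← ENNReal.ofReal_prod_of_nonneg fun i _ => hpos _ i]
  rw [← ENNReal.ofReal_sum_of_nonneg fun l _ => Finset.prod_nonneg fun i _ => hpos l i]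
  simp_rw [Finset.prod_mul_distrib]
  rw [← Finset.sum_mul, ← sum_pow_div_factorial, ← Real.exp_sum, ← Finset.sum_div,
    Finset.sum_neg_distrib]

/-- The cross-correlation of two gamma kernels. It is the weight of a vertex: `q` stands for the
flow which enters the vertex and leaves it again beyond its netflow `y`. -/
noncomputable def twoSidedKernel (a b : ℕ) (y : ℝ) : ℝ≥0∞ :=
  ∫⁻ q, gammaKernel b q * gammaKernel a (q + y)

@[fun_prop]
theorem measurable_twoSidedKernel (a b : ℕ) : Measurable (twoSidedKernel a b) := by
  unfold twoSidedKernel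
  fun_prop

theorem lintegral_gammaKernel_mul_twoSidedKernel_add (a b c : ℕ) (y : ℝ) :
    ∫⁻ p, gammaKernel c p * twoSidedKernel a b (y + p) = twoSidedKernel a (b + c + 1) y := by
  have hshift (p : ℝ) : gammaKernel c p * twoSidedKernel a b (y + p) =
      ∫⁻ r, gammaKernel c p * gammaKernel b (-p + r) * gammaKernel a (r + y) := by
    rw [twoSidedKernel, ← lintegral_const_mul _ (by fun_prop),
      ← lintegral_add_left_eq_self _ (-p)]
    refine lintegral_congr fun r => ?_
    rw [mul_assoc, show -p + r + (y + p) = r + y by ring]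
  simp_rw [hshift]
  rw [lintegral_lintegral_swap (by fun_prop), twoSidedKernel]
  refine lintegral_congr fun r => ?_
  rw [lintegral_mul_const _ (by fun_prop), ← gammaKernel_lconvolution c b, lconvolution_def]

theorem lintegral_gammaKernel_mul_twoSidedKernel_sub (a b c : ℕ) (y : ℝ) :
    ∫⁻ m, gammaKernel c m * twoSidedKernel a b (y - m) = twoSidedKernel (a + c + 1) b y := by
  have hmul (m : ℝ) : gammaKernel c m * twoSidedKernel a b (y - m) =
      ∫⁻ q, gammaKernel c m * (gammaKernel b q * gammaKernel a (q + (y - m))) :=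
    (lintegral_const_mul _ (by fun_prop)).symm
  simp_rw [hmul]
  rw [lintegral_lintegral_swap (by fun_prop)]
  refine lintegral_congr fun q => ?_
  rw [← gammaKernel_lconvolution c a, lconvolution_def, ← lintegral_const_mul _ (by fun_prop)]
  refine lintegral_congr fun m => ?_
  rw [mul_left_comm, show q + (y - m) = -m + (q + y) by ring]

theorem twoSidedKernel_sum {ι : Type*} [Fintype ι] [DecidableEq ι] (a b : ℕ) {t : ι → ℝ}
    (ht : ∀ i, 0 ≤ t i) :
    twoSidedKernel a b (∑ i, t i) =
      ∑ l ∈ Finset.piAntidiag (Finset.univ : Finset (Option ι)) a,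
        ((l none + b).choose (l none) : ℝ≥0∞) * ∏ i, gammaKernel (l (some i)) (t i) := by
  have hexpand (q : ℝ) : gammaKernel b q * gammaKernel a (q + ∑ i, t i) =
      ∑ l ∈ Finset.piAntidiag (Finset.univ : Finset (Option ι)) a,
        gammaKernel b q * gammaKernel (l none) q * ∏ i, gammaKernel (l (some i)) (t i) := by
    rcases lt_or_ge q 0 with hq | hq
    · simp [gammaKernel_of_neg b hq]
    have hsum := gammaKernel_sum a (t := fun i : Option ι => i.elim q t) (Option.forall.2 ⟨hq, ht⟩)
    simp only [Fintype.sum_option, Fintype.prod_option, Option.elim] at hsum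
    simp_rw [hsum, Finset.mul_sum, mul_assoc]
  simp_rw [twoSidedKernel, hexpand]
  rw [lintegral_finsetSum _ (by fun_prop)]
  refine Finset.sum_congr rfl fun l _ => ?_
  rw [lintegral_mul_const _ (by fun_prop), lintegral_gammaKernel_mul_gammaKernel]

/-! ### Integration over product spaces -/

section PiIntegral

variable {α : Type*} [MeasurableSpace α] (ν : Measure α) [SigmaFinite ν]

theorem lintegral_pi_sum {ι κ : Type*} [Fintype ι] [Fintype κ] {F : (ι ⊕ κ → α) → ℝ≥0∞}
    (hF : Measurable F) :
    ∫⁻ t, F t ∂Measure.pi (fun _ => ν) =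
      ∫⁻ u, ∫⁻ w, F (Sum.elim u w) ∂Measure.pi (fun _ => ν) ∂Measure.pi (fun _ => ν) := by
  have h := measurePreserving_sumPiEquivProdPi_symm (ι := ι) (ι' := κ) (X := fun _ => α)
    (fun _ => ν)
  rw [← h.lintegral_comp hF, lintegral_prod _ (by fun_prop)]
  rfl

theorem lintegral_pi_option {ι : Type*} [Fintype ι] {F : (Option ι → α) → ℝ≥0∞}
    (hF : Measurable F) :
    ∫⁻ t, F t ∂Measure.pi (fun _ => ν) =
      ∫⁻ w, ∫⁻ s, F (fun o => o.elim s w) ∂ν ∂Measure.pi (fun _ => ν) := by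
  have hm : Measurable (MeasurableEquiv.piOptionEquivProd (fun _ : Option ι => α)).symm :=
    MeasurableEquiv.measurable _
  rw [← Measure.pi_map_piOptionEquivProd (ι := ι) (β := fun _ => α) (fun _ => ν),
    lintegral_map hF hm, lintegral_prod _ (by fun_prop)]
  refine lintegral_congr fun w => lintegral_congr fun s => congrArg F ?_
  ext o
  cases o <;> rfl

theorem lintegral_pi_equiv {ι κ : Type*} [Fintype ι] [Fintype κ] (e : ι ≃ κ)
    {F : (κ → α) → ℝ≥0∞} (hF : Measurable F) :
    ∫⁻ t, F t ∂Measure.pi (fun _ => ν) = ∫⁻ t, F (t ∘ e.symm) ∂Measure.pi (fun _ => ν) := by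
  have h := measurePreserving_piCongrLeft (α := fun _ : κ => α) (fun _ => ν) e
  rw [← h.lintegral_comp hF]
  refine lintegral_congr fun t => congrArg F ?_
  ext i
  obtain ⟨i, rfl⟩ := e.surjective i
  rw [MeasurableEquiv.coe_piCongrLeft, Equiv.piCongrLeft_apply_apply]
  simp

theorem lintegral_pi_prod {ι : Type*} [Fintype ι] {g : ι → α → ℝ≥0∞}
    (hg : ∀ i, Measurable (g i)) :
    ∫⁻ t, ∏ i, g i (t i) ∂Measure.pi (fun _ => ν) = ∏ i, ∫⁻ s, g i s ∂ν := by
  revert g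
  refine Fintype.induction_empty_option (P := fun ι _ => ∀ {g : ι → α → ℝ≥0∞},
    (∀ i, Measurable (g i)) →
      ∫⁻ t, ∏ i, g i (t i) ∂Measure.pi (fun _ => ν) = ∏ i, ∫⁻ s, g i s ∂ν)
    (fun ι κ _ e ih g hg => ?_) (by simp) (fun ι _ ih g hg => ?_) ι
  · let := Fintype.ofEquiv κ e.symm
    rw [lintegral_pi_equiv ν e (by fun_prop), ← e.prod_comp, ← ih fun i => hg (e i)]
    refine lintegral_congr fun t => ?_
    simp [← e.prod_comp]
  · rw [lintegral_pi_option ν (by fun_prop), Fintype.prod_option,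
      ← ih fun i => hg (some i), ← lintegral_const_mul _ (by fun_prop)]
    refine lintegral_congr fun w => ?_
    simp_rw [Fintype.prod_option, Option.elim]
    exact lintegral_mul_const _ (hg none)

end PiIntegral

/-- Lebesgue measure on the nonnegative orthant. -/
noncomputable def orthantMeasure (ι : Type*) [Fintype ι] : Measure (ι → ℝ) :=
  Measure.pi fun _ => volume.restrict (Ici 0)

instance (ι : Type*) [Fintype ι] : SigmaFinite (orthantMeasure ι) := by
  unfold orthantMeasure
  infer_instance

theorem orthantMeasure_eq_restrict (ι : Type*) [Fintype ι] :
    orthantMeasure ι = volume.restrict {t : ι → ℝ | ∀ i, 0 ≤ t i} := by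
  have h : {t : ι → ℝ | ∀ i, 0 ≤ t i} = univ.pi fun _ => Ici 0 := by
    ext
    simp only [mem_ofPred_eq, mem_univ_pi, mem_Ici]
  rw [h, volume_pi, Measure.restrict_pi_pi]
  rfl

theorem ae_orthantMeasure_nonneg (ι : Type*) [Fintype ι] :
    ∀ᵐ t ∂orthantMeasure ι, ∀ i, 0 ≤ t i := by
  have hm : MeasurableSet {t : ι → ℝ | ∀ i, 0 ≤ t i} := by
    measurability
  rw [orthantMeasure_eq_restrict]
  exact ae_restrict_mem hm

/-! ### Netflows and cones of signed graphs -/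

namespace SignedGraph

section Netflow

variable {V E : Type*} [LinearOrder V]

theorem sum_root [Fintype V] (G : SignedGraph V E) (e : E) :
    ∑ v, G.root e v = if G.positive e then 2 else 0 := by
  simp only [root, Pi.add_apply, Finset.sum_add_distrib]
  split_ifs <;> simp

variable [Fintype E]

/-- The netflow of a real flow on the edges of a signed graph, as a function on the vertices. -/
noncomputable def netflow (G : SignedGraph V E) : (E → ℝ) →ₗ[ℝ] V → ℝ :=
  (G.rootMatrix.map (Int.cast : ℤ → ℝ)).mulVecLin

theorem netflow_apply (G : SignedGraph V E) (f : E → ℝ) (v : V) :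
    G.netflow f v = ∑ e, (G.root e v : ℝ) * f e :=
  rfl

theorem mem_flowPolytope_iff {G : SignedGraph V E} {a : V → ℤ} {f : EuclideanSpace ℝ E} :
    f ∈ G.flowPolytope a ↔ (∀ e, 0 ≤ f e) ∧ G.netflow f.ofLp = fun v => (a v : ℝ) :=
  Iff.rfl

@[fun_prop]
theorem continuous_netflow (G : SignedGraph V E) (v : V) :
    Continuous fun f => G.netflow f v := by
  simp only [netflow_apply]
  fun_prop

@[fun_prop]
theorem measurable_netflow (G : SignedGraph V E) (v : V) :
    Measurable fun f => G.netflow f v :=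
  (G.continuous_netflow v).measurable

theorem netflow_comp_equiv {E' : Type*} [Fintype E'] {G : SignedGraph V E}
    {H : SignedGraph V E'} (e : E ≃ E') (he : ∀ x, H.root (e x) = G.root x) (f : E' → ℝ) :
    G.netflow (f ∘ e) = H.netflow f := by
  ext v
  simp only [netflow_apply, ← e.sum_comp, he, Function.comp_apply]

end Netflow

/-- The edges at a new first vertex joined to `V`: its loop `none` and, for each `v : V`, the
positive edge `some (.inl v)` and the negative edge `some (.inr v)`. -/
abbrev ApexEdge (V : Type*) : Type _ :=
  Option (V ⊕ V)

variable {k : ℕ} {E : Type*}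

/-- The cone over a signed graph: a new first vertex is added, with a loop and with a positive and
a negative edge to each old vertex. -/
def cone (G : SignedGraph (Fin k) E) : SignedGraph (Fin (k + 1)) (ApexEdge (Fin k) ⊕ E) where
  left := Sum.elim (fun _ => 0) fun e => (G.left e).succ
  right := Sum.elim (fun o => o.elim 0 (Sum.elim Fin.succ Fin.succ)) fun e => (G.right e).succ
  positive := Sum.elim (fun o => o.elim true (Sum.elim (fun _ => true) fun _ => false)) G.positive
  left_le_right := by
    rintro (_ | e)
    · exact Fin.zero_le _
    · exact Fin.succ_le_succ_iff.2 (G.left_le_right e)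
  positive_of_loop := by
    rintro ((_ | _ | v) | e) h
    · rfl
    · rfl
    · exact absurd h (Fin.succ_ne_zero v).symm
    · exact G.positive_of_loop e (Fin.succ_injective _ h)

theorem root_cone_loop (G : SignedGraph (Fin k) E) :
    G.cone.root (.inl none) = Fin.cons 2 0 := by
  ext v
  cases v using Fin.cases <;> simp [root, cone]

theorem root_cone_pos (G : SignedGraph (Fin k) E) (v : Fin k) :
    G.cone.root (.inl (some (.inl v))) = Fin.cons 1 (Pi.single v 1) := by
  ext w
  cases w using Fin.cases <;> simp [root, cone, Pi.single_apply]

theorem root_cone_neg (G : SignedGraph (Fin k) E) (v : Fin k) :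
    G.cone.root (.inl (some (.inr v))) = Fin.cons 1 (-Pi.single v 1) := by
  ext w
  cases w using Fin.cases <;> simp [root, cone, Pi.single_apply]

theorem root_cone_old (G : SignedGraph (Fin k) E) (e : E) :
    G.cone.root (.inr e) = Fin.cons 0 (G.root e) := by
  ext w
  cases w using Fin.cases <;> cases h : G.positive e <;> simp [root, cone, Pi.single_apply, h]

theorem netflow_cone_zero [Fintype E] (G : SignedGraph (Fin k) E) (f : ApexEdge (Fin k) ⊕ E → ℝ) :
    G.cone.netflow f 0 = 2 * f (.inl none) +
      ((∑ v, f (.inl (some (.inl v)))) + ∑ v, f (.inl (some (.inr v)))) := by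
  simp [netflow_apply, root_cone_loop, root_cone_pos, root_cone_neg, root_cone_old]

theorem netflow_cone_succ [Fintype E] (G : SignedGraph (Fin k) E) (f : ApexEdge (Fin k) ⊕ E → ℝ)
    (v : Fin k) :
    G.cone.netflow f v.succ = G.netflow (fun e => f (.inr e)) v + f (.inl (some (.inl v))) -
      f (.inl (some (.inr v))) := by
  simp [netflow_apply, root_cone_loop, root_cone_pos, root_cone_neg, root_cone_old,
    Pi.single_apply]
  ring

end SignedGraph

open SignedGraph

/-- The edges of the complete type `C` graph are the edges at the first vertex and the edges among
the other vertices. -/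
def completeCEdgeOfCone (k : ℕ) : ApexEdge (Fin k) ⊕ CompleteCEdge k → CompleteCEdge (k + 1)
  | .inl none => ⟨(0, 0, true), .inr ⟨rfl, rfl⟩⟩
  | .inl (some (.inl j)) => ⟨(0, j.succ, true), .inl j.succ_pos⟩
  | .inl (some (.inr j)) => ⟨(0, j.succ, false), .inl j.succ_pos⟩
  | .inr e => ⟨(e.1.1.succ, e.1.2.1.succ, e.1.2.2),
      e.2.imp Fin.succ_lt_succ_iff.2 (And.imp_left (congrArg Fin.succ))⟩

theorem completeCEdgeOfCone_bijective (k : ℕ) : Function.Bijective (completeCEdgeOfCone k) := by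
  constructor
  · rintro ((_ | _ | _) | ⟨⟨_, _, _⟩, _⟩) ((_ | _ | _) | ⟨⟨_, _, _⟩, _⟩) h <;>
      simp_all [completeCEdgeOfCone, Fin.ext_iff]
  · rintro ⟨⟨i, j, s⟩, h⟩
    induction i using Fin.cases with
    | zero =>
      induction j using Fin.cases with
      | zero =>
        obtain rfl : s = true := by simpa using h
        exact ⟨.inl none, rfl⟩
      | succ j =>
        cases s
        · exact ⟨.inl (some (.inr j)), rfl⟩
        · exact ⟨.inl (some (.inl j)), rfl⟩
    | succ i =>
      induction j using Fin.cases with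
      | zero => simp at h
      | succ j => exact ⟨.inr ⟨(i, j, s), by simpa using h⟩, rfl⟩

/-- The relabelling of edges that identifies `completeC (k + 1)` with the cone over
`completeC k`. -/
noncomputable def completeCEdgeEquiv (k : ℕ) :
    ApexEdge (Fin k) ⊕ CompleteCEdge k ≃ CompleteCEdge (k + 1) :=
  Equiv.ofBijective _ (completeCEdgeOfCone_bijective k)

theorem root_completeCEdgeEquiv (k : ℕ) (e : ApexEdge (Fin k) ⊕ CompleteCEdge k) :
    (completeC (k + 1)).root (completeCEdgeEquiv k e) = (completeC k).cone.root e := by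
  obtain ((_ | _ | _) | e) := e <;> rfl

/-! ### Integrals over flows -/

section ApexIntegral

variable {V : Type*} [Fintype V]

theorem lintegral_orthant_prod_gammaKernel_mul_twoSidedKernel_add (a b c : V → ℕ) (y : V → ℝ) :
    ∫⁻ p, ∏ v, (gammaKernel (c v) (p v) * twoSidedKernel (a v) (b v) (y v + p v))
      ∂orthantMeasure V = ∏ v, twoSidedKernel (a v) (b v + c v + 1) (y v) := by
  unfold orthantMeasure
  rw [lintegral_pi_prod _ (g := fun v s => gammaKernel (c v) s *
    twoSidedKernel (a v) (b v) (y v + s)) (by fun_prop)]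
  simp_rw [setLIntegral_Ici_gammaKernel_mul, lintegral_gammaKernel_mul_twoSidedKernel_add]

theorem lintegral_orthant_prod_gammaKernel_mul_twoSidedKernel_sub (a b c : V → ℕ) (y : V → ℝ) :
    ∫⁻ m, ∏ v, (gammaKernel (c v) (m v) * twoSidedKernel (a v) (b v) (y v - m v))
      ∂orthantMeasure V = ∏ v, twoSidedKernel (a v + c v + 1) (b v) (y v) := by
  unfold orthantMeasure
  rw [lintegral_pi_prod _ (g := fun v s => gammaKernel (c v) s *
    twoSidedKernel (a v) (b v) (y v - s)) (by fun_prop)]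
  simp_rw [setLIntegral_Ici_gammaKernel_mul, lintegral_gammaKernel_mul_twoSidedKernel_sub]

/-- The product of the gamma kernels of the contributions which the edges at a new first vertex
make to the netflow there; the loop contributes twice its flow. -/
noncomputable def apexKernel (l : ApexEdge V → ℕ) (w : ApexEdge V → ℝ) : ℝ≥0∞ :=
  gammaKernel (l none) (2 * w none) * ((∏ v, gammaKernel (l (some (.inl v))) (w (some (.inl v)))) *
    ∏ v, gammaKernel (l (some (.inr v))) (w (some (.inr v))))

@[fun_prop]
theorem measurable_apexKernel (l : ApexEdge V → ℕ) : Measurable (apexKernel l) := by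
  unfold apexKernel
  fun_prop

theorem twoSidedKernel_apex_netflow [DecidableEq V] (a b : ℕ) {w : ApexEdge V → ℝ}
    (hw : ∀ o, 0 ≤ w o) :
    twoSidedKernel a b (2 * w none + ((∑ v, w (some (.inl v))) + ∑ v, w (some (.inr v)))) =
      ∑ l ∈ Finset.piAntidiag (Finset.univ : Finset (Option (ApexEdge V))) a,
        ((l none + b).choose (l none) : ℝ≥0∞) * apexKernel (l ∘ some) w := by
  have hsum := twoSidedKernel_sum a b
    (t := fun o : ApexEdge V => o.elim (2 * w none) fun i => w (some i))
    (by rintro (_ | i) <;> simp [hw])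
  simpa only [Fintype.sum_option, Fintype.sum_sum_type, Fintype.prod_option,
    Fintype.prod_sum_type, Option.elim, apexKernel, Function.comp_apply] using hsum

theorem lintegral_apexKernel_mul_prod_twoSidedKernel (l : ApexEdge V → ℕ) (a b : V → ℕ)
    (y : V → ℝ) :
    ∫⁻ w, apexKernel l w *
        ∏ v, twoSidedKernel (a v) (b v) (y v + w (some (.inl v)) - w (some (.inr v)))
      ∂orthantMeasure (ApexEdge V) =
    2 ^ l none * ∏ v, twoSidedKernel (a v + l (some (.inr v)) + 1)
      (b v + l (some (.inl v)) + 1) (y v) := by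
  have hloop (w : V ⊕ V → ℝ) : ∫⁻ s in Ici (0 : ℝ), apexKernel l (fun o => o.elim s w) *
        ∏ v, twoSidedKernel (a v) (b v) (y v + w (.inl v) - w (.inr v)) =
      2 ^ l none * ((∏ v, gammaKernel (l (some (.inl v))) (w (.inl v))) *
        ∏ v, (gammaKernel (l (some (.inr v))) (w (.inr v)) *
          twoSidedKernel (a v) (b v) (y v + w (.inl v) - w (.inr v)))) := by
    simp_rw [apexKernel, Option.elim, mul_assoc]
    rw [lintegral_mul_const _ (by fun_prop), setLIntegral_Ici_gammaKernel_two_mul,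
      Finset.prod_mul_distrib]
  have hneg (p : V → ℝ) : ∫⁻ m, (∏ v, gammaKernel (l (some (.inl v))) (p v)) *
        ∏ v, (gammaKernel (l (some (.inr v))) (m v) *
          twoSidedKernel (a v) (b v) (y v + p v - m v)) ∂orthantMeasure V =
      ∏ v, (gammaKernel (l (some (.inl v))) (p v) *
        twoSidedKernel (a v + l (some (.inr v)) + 1) (b v) (y v + p v)) := by
    rw [lintegral_const_mul _ (by fun_prop), Finset.prod_mul_distrib,
      lintegral_orthant_prod_gammaKernel_mul_twoSidedKernel_sub]
  rw [orthantMeasure, lintegral_pi_option _ (by fun_prop)]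
  simp_rw [Option.elim_some, hloop]
  rw [lintegral_const_mul _ (by fun_prop), lintegral_pi_sum _ (by fun_prop)]
  rw [← orthantMeasure]
  simp_rw [Sum.elim_inl, Sum.elim_inr, hneg]
  rw [lintegral_orthant_prod_gammaKernel_mul_twoSidedKernel_add]

theorem lintegral_orthant_apex [DecidableEq V] (a b : ℕ) (a' b' : V → ℕ) (y : V → ℝ) :
    ∫⁻ w, twoSidedKernel a b
          (2 * w none + ((∑ v, w (some (.inl v))) + ∑ v, w (some (.inr v)))) *
        ∏ v, twoSidedKernel (a' v) (b' v) (y v + w (some (.inl v)) - w (some (.inr v)))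
      ∂orthantMeasure (ApexEdge V) =
    ∑ l ∈ Finset.piAntidiag (Finset.univ : Finset (Option (ApexEdge V))) a,
      ((l none + b).choose (l none) : ℝ≥0∞) * (2 ^ l (some none) *
        ∏ v, twoSidedKernel (a' v + l (some (some (.inr v))) + 1)
          (b' v + l (some (some (.inl v))) + 1) (y v)) := by
  rw [lintegral_congr_ae ((ae_orthantMeasure_nonneg _).mono fun w hw => congrArg
    (· * ∏ v, twoSidedKernel (a' v) (b' v) (y v + w (some (.inl v)) - w (some (.inr v))))
    (twoSidedKernel_apex_netflow a b hw))]
  simp_rw [Finset.sum_mul, mul_assoc]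
  rw [lintegral_finsetSum _ (by fun_prop)]
  refine Finset.sum_congr rfl fun l _ => ?_
  rw [lintegral_const_mul _ (by fun_prop), lintegral_apexKernel_mul_prod_twoSidedKernel]
  rfl

end ApexIntegral

/-- The integral over all nonnegative flows of the product over the vertices of the two-sided
kernels of the netflows. -/
noncomputable def flowIntegral {V E : Type*} [LinearOrder V] [Fintype V] [Fintype E]
    (G : SignedGraph V E) (a b : V → ℕ) : ℝ≥0∞ :=
  ∫⁻ f, ∏ v, twoSidedKernel (a v) (b v) (G.netflow f v) ∂orthantMeasure E

theorem flowIntegral_congr {V E E' : Type*} [LinearOrder V] [Fintype V] [Fintype E] [Fintype E']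
    {G : SignedGraph V E} {H : SignedGraph V E'} (e : E ≃ E')
    (he : ∀ x, H.root (e x) = G.root x) (a b : V → ℕ) :
    flowIntegral G a b = flowIntegral H a b := by
  unfold flowIntegral orthantMeasure
  rw [lintegral_pi_equiv _ e.symm (by fun_prop)]
  simp_rw [e.symm_symm, netflow_comp_equiv e he]

theorem flowIntegral_cone {k : ℕ} {E : Type*} [Fintype E] (G : SignedGraph (Fin k) E)
    (a b : Fin (k + 1) → ℕ) :
    flowIntegral G.cone a b =
      ∑ l ∈ Finset.piAntidiag (Finset.univ : Finset (Option (ApexEdge (Fin k)))) (a 0),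
        ((l none + b 0).choose (l none) : ℝ≥0∞) * (2 ^ l (some none) *
          flowIntegral G (fun j => a j.succ + l (some (some (.inr j))) + 1)
            (fun j => b j.succ + l (some (some (.inl j))) + 1)) := by
  rw [flowIntegral, orthantMeasure, lintegral_pi_sum _ (by fun_prop)]
  simp_rw [Fin.prod_univ_succ, netflow_cone_zero, netflow_cone_succ, Sum.elim_inl, Sum.elim_inr]
  rw [← orthantMeasure, ← orthantMeasure, lintegral_lintegral_swap (by fun_prop)]
  simp_rw [lintegral_orthant_apex]
  rw [lintegral_finsetSum _ (by fun_prop)]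
  refine Finset.sum_congr rfl fun l _ => ?_
  rw [lintegral_const_mul _ (by fun_prop), lintegral_const_mul _ (by fun_prop), flowIntegral]

/-- The recursion obtained by removing the first of `k` vertices: its exponent `a 0` is distributed
over the flow passing through it (`none`) and the edges at it, each of which to another vertex
raises an exponent there. It computes both flow integrals and iterated constant terms. -/
def flowCount : (k : ℕ) → (Fin k → ℕ) → (Fin k → ℕ) → ℕ
  | 0, _, _ => 1
  | k + 1, a, b =>
    ∑ l ∈ Finset.piAntidiag (Finset.univ : Finset (Option (ApexEdge (Fin k)))) (a 0),
      (l none + b 0).choose (l none) * 2 ^ l (some none) *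
        flowCount k (fun j => a j.succ + l (some (some (.inr j))) + 1)
          (fun j => b j.succ + l (some (some (.inl j))) + 1)

theorem flowIntegral_completeC (k : ℕ) (a b : Fin k → ℕ) :
    flowIntegral (completeC k) a b = flowCount k a b := by
  induction k with
  | zero =>
    have : IsEmpty (CompleteCEdge 0) := ⟨fun e => e.1.1.elim0⟩
    simp [flowIntegral, flowCount, orthantMeasure]
  | succ k ih =>
    rw [← flowIntegral_congr _ (root_completeCEdgeEquiv k), flowIntegral_cone, flowCount]
    push_cast
    simp_rw [ih, mul_assoc]

/-! ### Iterated constant terms -/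

theorem coeff_prod_univ_eq_sum_piAntidiag {R ι : Type*} [CommSemiring R] [Fintype ι]
    [DecidableEq ι] (f : ι → PowerSeries R) (d : ℕ) :
    PowerSeries.coeff d (∏ i, f i) =
      ∑ l ∈ Finset.piAntidiag Finset.univ d, ∏ i, PowerSeries.coeff (l i) (f i) := by
  rw [PowerSeries.coeff_prod]
  refine Finset.sum_bij' (fun l _ => ⇑l) (fun l _ => Finsupp.equivFunOnFinite.symm l)
    ?_ ?_ ?_ ?_ ?_ <;> simp

theorem C_sub_C_mul_X_mul_mk_pow_mul_inv_pow {K : Type*} [Field K] {u : K} (hu : u ≠ 0) (v : K) :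
    (PowerSeries.C u - PowerSeries.C v * PowerSeries.X) *
      PowerSeries.mk (fun n => v ^ n * u⁻¹ ^ (n + 1)) = 1 := by
  ext n
  rw [sub_mul, mul_assoc, map_sub, PowerSeries.coeff_C_mul, PowerSeries.coeff_C_mul]
  cases n with
  | zero => simp [hu]
  | succ n =>
    rw [PowerSeries.coeff_succ_X_mul, PowerSeries.coeff_mk, PowerSeries.coeff_mk,
      PowerSeries.coeff_one, if_neg n.succ_ne_zero]
    linear_combination v ^ (n + 1) * u⁻¹ ^ (n + 1) * mul_inv_cancel₀ hu

theorem one_sub_X_pow_mul_mk_choose {R : Type*} [CommRing R] (b : ℕ) :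
    (1 - PowerSeries.X) ^ (b + 1) * PowerSeries.mk (fun n => ((n + b).choose n : R)) = 1 := by
  have h := (PowerSeries.invOneSubPow R (b + 1)).inv_mul
  rw [PowerSeries.invOneSubPow_val_succ_eq_mk_add_choose, ← Units.inv_eq_val_inv,
    PowerSeries.invOneSubPow_inv_eq_one_sub_pow] at h
  have hchoose (n : ℕ) : (n + b).choose n = (b + n).choose b := by
    rw [add_comm n b, Nat.choose_symm_add]
  simpa only [hchoose] using h

namespace RatFun

variable {σ : Type*}

theorem x_ne_zero (i : σ) : x i ≠ 0 :=
  (map_ne_zero_iff _ (IsFractionRing.injective (MvPolynomial σ ℝ) (RatFun σ))).2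
    (MvPolynomial.X_ne_zero i)

theorem one_sub_x_ne_zero (i : σ) : 1 - x i ≠ 0 := by
  rw [x, ← map_one (algebraMap (MvPolynomial σ ℝ) (RatFun σ)), ← map_sub,
    map_ne_zero_iff _ (IsFractionRing.injective (MvPolynomial σ ℝ) (RatFun σ))]
  intro h
  simpa using congrArg (MvPolynomial.eval fun _ => (0 : ℝ)) h

/-- The rational function in the variables `x_{v 1}, …, x_{v k}` of the constant term identity,
with arbitrary exponents of the `x_{v i}` and the `1 - x_{v i}`. -/
noncomputable def kernelProduct {k : ℕ} (v : Fin k → σ) (a b : Fin k → ℕ) : RatFun σ :=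
  (∏ i, (x (v i))⁻¹ ^ a i * ((1 - x (v i)) ^ (b i + 1))⁻¹ * (1 - 2 * x (v i))⁻¹) *
    ∏ i, ∏ j ∈ Finset.Ioi i, (x (v j) - x (v i))⁻¹ * (1 - x (v j) - x (v i))⁻¹

theorem kernelProduct_succ {k : ℕ} (v : Fin (k + 1) → σ) (a b : Fin (k + 1) → ℕ) :
    kernelProduct v a b =
      (x (v 0))⁻¹ ^ a 0 *
        (((1 - x (v 0)) ^ (b 0 + 1))⁻¹ * ((1 - 2 * x (v 0))⁻¹ *
          ((∏ j : Fin k, (1 - x (v j.succ) - x (v 0))⁻¹) *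
            ∏ j : Fin k, (x (v j.succ) - x (v 0))⁻¹))) *
        kernelProduct (fun j => v j.succ) (fun j => a j.succ) fun j => b j.succ := by
  unfold kernelProduct
  rw [Fin.prod_univ_succ, Fin.prod_univ_succ, Fin.prod_Ioi_zero]
  simp_rw [Fin.prod_Ioi_succ]
  rw [Finset.prod_mul_distrib (f := fun j : Fin k => (x (v j.succ) - x (v 0))⁻¹)]
  ring

theorem prod_inv_pow_mul_kernelProduct {k : ℕ} (v : Fin k → σ) (a b c d : Fin k → ℕ) :
    (∏ j, ((x (v j))⁻¹ ^ (c j + 1) * (1 - x (v j))⁻¹ ^ (d j + 1))) * kernelProduct v a b =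
      kernelProduct v (fun j => a j + c j + 1) (fun j => b j + d j + 1) := by
  unfold kernelProduct
  rw [← mul_assoc, ← Finset.prod_mul_distrib]
  congr 1
  refine Finset.prod_congr rfl fun j _ => ?_
  simp only [← inv_pow]
  ring

variable [DecidableEq σ]

theorem laurentExpansion_x_self (i : σ) :
    laurentExpansion i (x i) = HahnSeries.ofPowerSeries ℤ (RatFun σ) PowerSeries.X := by
  unfold laurentExpansion x
  rw [IsFractionRing.lift_algebraMap]
  simp [polyToLaurent, asPolynomialIn, Polynomial.algebraMap_hahnSeries_apply]

/-- The rational functions which are constant with respect to `x_i`, in the sense that their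
Laurent expansion in `x_i` is a constant series. -/
noncomputable def constantsIn (i : σ) : Subfield (RatFun σ) :=
  (laurentExpansion i).eqLocusField HahnSeries.C

theorem mem_constantsIn {i : σ} {f : RatFun σ} :
    f ∈ constantsIn i ↔ laurentExpansion i f = HahnSeries.C f :=
  Iff.rfl

theorem x_mem_constantsIn {i j : σ} (h : j ≠ i) : x j ∈ constantsIn i := by
  rw [mem_constantsIn, laurentExpansion]
  conv_lhs => rw [x]
  rw [IsFractionRing.lift_algebraMap]
  simp [polyToLaurent, asPolynomialIn, h, Polynomial.algebraMap_hahnSeries_apply]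

theorem laurentExpansion_inv {i : σ} {f : RatFun σ} {p q : PowerSeries (RatFun σ)}
    (hf : laurentExpansion i f = HahnSeries.ofPowerSeries ℤ (RatFun σ) p) (hpq : p * q = 1) :
    laurentExpansion i f⁻¹ = HahnSeries.ofPowerSeries ℤ (RatFun σ) q := by
  rw [map_inv₀, hf]
  refine inv_eq_of_mul_eq_one_right ?_
  rw [← map_mul, hpq, map_one]

theorem laurentExpansion_inv_one_sub_pow (i : σ) (b : ℕ) :
    laurentExpansion i ((1 - x i) ^ (b + 1))⁻¹ = HahnSeries.ofPowerSeries ℤ (RatFun σ)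
      (PowerSeries.mk fun n => ((n + b).choose n : RatFun σ)) := by
  refine laurentExpansion_inv ?_ (one_sub_X_pow_mul_mk_choose b)
  simp only [map_pow, map_sub, map_one, laurentExpansion_x_self]

theorem laurentExpansion_inv_sub_mul_x {i : σ} {u v : RatFun σ} (hu : u ∈ constantsIn i)
    (hv : v ∈ constantsIn i) (hu₀ : u ≠ 0) :
    laurentExpansion i (u - v * x i)⁻¹ = HahnSeries.ofPowerSeries ℤ (RatFun σ)
      (PowerSeries.mk fun n => v ^ n * u⁻¹ ^ (n + 1)) := by
  refine laurentExpansion_inv ?_ (C_sub_C_mul_X_mul_mk_pow_mul_inv_pow hu₀ v)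
  rw [map_sub, map_mul, laurentExpansion_x_self, mem_constantsIn.1 hu, mem_constantsIn.1 hv,
    map_sub, map_mul, HahnSeries.ofPowerSeries_C, HahnSeries.ofPowerSeries_C]

theorem laurentExpansion_inv_sub_x {i : σ} {u : RatFun σ} (hu : u ∈ constantsIn i)
    (hu₀ : u ≠ 0) :
    laurentExpansion i (u - x i)⁻¹ = HahnSeries.ofPowerSeries ℤ (RatFun σ)
      (PowerSeries.mk fun n => u⁻¹ ^ (n + 1)) := by
  simpa using laurentExpansion_inv_sub_mul_x hu (one_mem _) hu₀

theorem laurentExpansion_inv_one_sub_two_mul (i : σ) :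
    laurentExpansion i (1 - 2 * x i)⁻¹ = HahnSeries.ofPowerSeries ℤ (RatFun σ)
      (PowerSeries.mk fun n => 2 ^ n) := by
  simpa using laurentExpansion_inv_sub_mul_x (one_mem (constantsIn i)) (ofNat_mem _ 2) one_ne_zero

theorem CT_inv_x_pow_mul_mul {i : σ} {f c : RatFun σ} {p : PowerSeries (RatFun σ)}
    (hf : laurentExpansion i f = HahnSeries.ofPowerSeries ℤ (RatFun σ) p)
    (hc : c ∈ constantsIn i) (a : ℕ) :
    CT i ((x i)⁻¹ ^ a * f * c) = PowerSeries.coeff a p * c := by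
  have hx : laurentExpansion i ((x i)⁻¹ ^ a) = HahnSeries.single (-(a : ℤ)) 1 := by
    rw [map_pow, map_inv₀, laurentExpansion_x_self, HahnSeries.ofPowerSeries_X]
    simp [HahnSeries.inv_single]
  rw [CT, map_mul, map_mul, hx, hf, mem_constantsIn.1 hc, mul_assoc,
    show (0 : ℤ) = (a : ℤ) + -(a : ℤ) by ring, HahnSeries.coeff_single_mul_add, one_mul,
    HahnSeries.C_apply, HahnSeries.coeff_mul_single_zero, LaurentSeries.coeff_coe_powerSeries]

theorem CT_sum {ι : Type*} (i : σ) (s : Finset ι) (f : ι → RatFun σ) :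
    CT i (∑ l ∈ s, f l) = ∑ l ∈ s, CT i (f l) := by
  simp [CT, map_sum, HahnSeries.coeff_sum]

theorem CT_natCast_mul (i : σ) (c : ℕ) (f : RatFun σ) : CT i (c * f) = c * CT i f := by
  rw [← nsmul_eq_mul, ← nsmul_eq_mul, CT, map_nsmul, HahnSeries.coeff_nsmul]
  rfl

theorem foldl_CT_sum_natCast_mul {ι : Type*} (L : List σ) (s : Finset ι) (c : ι → ℕ)
    (f : ι → RatFun σ) :
    L.foldl (fun g i => CT i g) (∑ l ∈ s, (c l : RatFun σ) * f l) =
      ∑ l ∈ s, (c l : RatFun σ) * L.foldl (fun g i => CT i g) (f l) := by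
  induction L generalizing f with
  | nil => rfl
  | cons i L ih => simp only [List.foldl_cons, CT_sum, CT_natCast_mul, ih]

/-- The power series in `x_i`, with the other variables `y` as constants, of the factors
`(1 - x_i) ^ -(b + 1)`, `(1 - 2 x_i)⁻¹`, `(1 - y_j - x_i)⁻¹` and `(y_j - x_i)⁻¹` of the kernel.
They stand for the flow through the vertex `i`, its loop, and its positive and negative edges. -/
noncomputable def vertexSeries {K ι : Type*} [Field K] (b : ℕ) (y : ι → K) :
    Option (ApexEdge ι) → PowerSeries K
  | none => PowerSeries.mk fun n => ((n + b).choose n : K)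
  | some none => PowerSeries.mk fun n => 2 ^ n
  | some (some (.inl j)) => PowerSeries.mk fun n => (1 - y j)⁻¹ ^ (n + 1)
  | some (some (.inr j)) => PowerSeries.mk fun n => (y j)⁻¹ ^ (n + 1)

theorem coeff_prod_vertexSeries {K ι : Type*} [Field K] [Fintype ι] [DecidableEq ι] (a b : ℕ)
    (y : ι → K) :
    PowerSeries.coeff a (∏ o, vertexSeries b y o) =
      ∑ l ∈ Finset.piAntidiag (Finset.univ : Finset (Option (ApexEdge ι))) a,
        (((l none + b).choose (l none) * 2 ^ l (some none) : ℕ) : K) *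
          ∏ j, ((y j)⁻¹ ^ (l (some (some (.inr j))) + 1) *
            (1 - y j)⁻¹ ^ (l (some (some (.inl j))) + 1)) := by
  rw [coeff_prod_univ_eq_sum_piAntidiag]
  refine Finset.sum_congr rfl fun l _ => ?_
  simp only [Fintype.prod_option, Fintype.prod_sum_type, vertexSeries, PowerSeries.coeff_mk,
    Finset.prod_mul_distrib]
  push_cast
  ring

theorem laurentExpansion_vertexFactors {ι : Type*} [Fintype ι] {i : σ} {v : ι → σ}
    (hv : ∀ j, v j ≠ i) (b : ℕ) :
    laurentExpansion i (((1 - x i) ^ (b + 1))⁻¹ * ((1 - 2 * x i)⁻¹ *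
      ((∏ j, (1 - x (v j) - x i)⁻¹) * ∏ j, (x (v j) - x i)⁻¹))) =
    HahnSeries.ofPowerSeries ℤ (RatFun σ) (∏ o, vertexSeries b (fun j => x (v j)) o) := by
  have hx (j : ι) : x (v j) ∈ constantsIn i := x_mem_constantsIn (hv j)
  simp only [map_mul, map_prod, laurentExpansion_inv_one_sub_pow,
    laurentExpansion_inv_one_sub_two_mul, laurentExpansion_inv_sub_x (hx _) (x_ne_zero _),
    laurentExpansion_inv_sub_x (sub_mem (one_mem _) (hx _)) (one_sub_x_ne_zero _),
    Fintype.prod_option, Fintype.prod_sum_type, vertexSeries]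

theorem kernelProduct_mem_constantsIn {k : ℕ} {v : Fin k → σ} {i : σ} (hv : ∀ j, v j ≠ i)
    (a b : Fin k → ℕ) : kernelProduct v a b ∈ constantsIn i := by
  have hx (j : Fin k) : laurentExpansion i (x (v j)) = HahnSeries.C (x (v j)) :=
    x_mem_constantsIn (hv j)
  simp only [mem_constantsIn, kernelProduct, map_mul, map_prod, map_inv₀, map_pow, map_sub,
    map_one, map_ofNat, hx]

theorem CT_kernelProduct {k : ℕ} {v : Fin (k + 1) → σ} (hv : Function.Injective v)
    (a b : Fin (k + 1) → ℕ) :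
    CT (v 0) (kernelProduct v a b) =
      ∑ l ∈ Finset.piAntidiag (Finset.univ : Finset (Option (ApexEdge (Fin k)))) (a 0),
        (((l none + b 0).choose (l none) * 2 ^ l (some none) : ℕ) : RatFun σ) *
          kernelProduct (fun j => v j.succ) (fun j => a j.succ + l (some (some (.inr j))) + 1)
            (fun j => b j.succ + l (some (some (.inl j))) + 1) := by
  have hne (j : Fin k) : v j.succ ≠ v 0 := fun h => Fin.succ_ne_zero j (hv h)
  rw [kernelProduct_succ, CT_inv_x_pow_mul_mul (laurentExpansion_vertexFactors hne (b 0))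
    (kernelProduct_mem_constantsIn hne _ _), coeff_prod_vertexSeries, Finset.sum_mul]
  simp_rw [mul_assoc, prod_inv_pow_mul_kernelProduct]

theorem foldl_CT_kernelProduct {k : ℕ} {v : Fin k → σ} (hv : Function.Injective v)
    (a b : Fin k → ℕ) :
    (List.ofFn v).foldl (fun g i => CT i g) (kernelProduct v a b) = flowCount k a b := by
  induction k with
  | zero => simp [kernelProduct, flowCount]
  | succ k ih =>
    have hsucc : Function.Injective fun j : Fin k => v j.succ := hv.comp (Fin.succ_injective k)
    rw [List.ofFn_succ, List.foldl_cons, CT_kernelProduct hv, foldl_CT_sum_natCast_mul, flowCount]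
    simp_rw [ih hsucc]
    push_cast
    rfl

theorem iteratedCT_kernelProduct (m : ℕ) (a b : Fin m → ℕ) :
    iteratedCT (kernelProduct (fun i : Fin m => i) a b) = flowCount m a b := by
  rw [iteratedCT, ← foldl_CT_kernelProduct (v := fun i : Fin m => i) (fun _ _ h => h),
    List.finRange]

end RatFun

/-! ### Normalized volumes in lattice coordinates -/

theorem volume_real_div_covolume_eq {E κ : Type*} [NormedAddCommGroup E] [InnerProductSpace ℝ E]
    [FiniteDimensional ℝ E] [MeasurableSpace E] [BorelSpace E] [Fintype κ]
    (b : Module.Basis κ ℝ E) {L : Submodule ℤ E} (hL : L = Submodule.span ℤ (range b))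
    {S : Set E} (hS : MeasurableSet S) :
    volume.real S / ZLattice.covolume L = volume.real (b.equivFun '' S) := by
  subst hL
  have hb : (b.restrictScalars ℤ).ofZLatticeBasis ℝ (Submodule.span ℤ (range b)) = b := by
    ext i
    rw [Module.Basis.ofZLatticeBasis_apply, Module.Basis.restrictScalars_apply]
  have h := ZLattice.volume_image_eq_volume_div_covolume' (Submodule.span ℤ (range b))
    (b.restrictScalars ℤ) hS.nullMeasurableSet
  rw [hb] at h
  rw [measureReal_def, measureReal_def, h, ENNReal.toReal_div,
    ENNReal.toReal_ofReal (ZLattice.covolume_pos _ volume).le]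

theorem vectorSpan_image_add_const {V W : Type*} [NormedAddCommGroup V] [NormedSpace ℝ V]
    [AddCommGroup W] [Module ℝ W] (Φ : V →ₗ[ℝ] W) (c : W) {Q : Set V}
    (hQ : (interior Q).Nonempty) :
    vectorSpan ℝ ((fun q => Φ q + c) '' Q) = LinearMap.range Φ := by
  have hQspan : vectorSpan ℝ Q = ⊤ := by
    refine AffineSubspace.vectorSpan_eq_top_of_affineSpan_eq_top ℝ _ _ (eq_top_iff.2 ?_)
    rw [← isOpen_interior.affineSpan_eq_top hQ]
    exact affineSpan_mono ℝ interior_subset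
  have himage : (fun q => Φ q + c) '' Q = (Φ.toAffineMap + AffineMap.const ℝ V c) '' Q := rfl
  rw [himage, ← AffineMap.map_vectorSpan, hQspan]
  simp

section NormalizedVolume

variable {ι κ : Type*} [Fintype ι] [Fintype κ]

theorem mem_directionLattice_iff {P : Set (EuclideanSpace ℝ ι)} {w : vectorSpan ℝ P} :
    w ∈ directionLattice P ↔ ∀ j, (w : EuclideanSpace ℝ ι) j ∈ range ((↑) : ℤ → ℝ) := by
  rw [directionLattice, Submodule.mem_comap, ← OrthonormalBasis.coe_toBasis,
    Module.Basis.mem_span_iff_repr_mem]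
  rfl

theorem directionLattice_eq_span {κ : Type*} [Finite κ] {P : Set (EuclideanSpace ℝ ι)}
    (Ψ : (κ → ℝ) ≃ₗ[ℝ] vectorSpan ℝ P)
    (hΨ : ∀ q, (∀ j, (Ψ q : EuclideanSpace ℝ ι) j ∈ range ((↑) : ℤ → ℝ)) ↔
      ∀ i, q i ∈ range ((↑) : ℤ → ℝ)) :
    directionLattice P = Submodule.span ℤ (range (Module.Basis.ofEquivFun Ψ.symm)) := by
  ext w
  obtain ⟨q, rfl⟩ := Ψ.surjective w
  rw [mem_directionLattice_iff, hΨ, Module.Basis.mem_span_iff_repr_mem]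
  simp_rw [← Module.Basis.equivFun_apply, Module.Basis.equivFun_ofEquivFun, Ψ.symm_apply_apply]
  rfl

theorem normalizedVolume_eq_of_basis {P : Set (EuclideanSpace ℝ ι)} (hP : P.Nonempty)
    (hPm : MeasurableSet P) (b : Module.Basis κ ℝ (vectorSpan ℝ P))
    (hb : directionLattice P = Submodule.span ℤ (range b)) :
    normalizedVolume P = (Fintype.card κ)! *
      volume.real (b.equivFun '' {v | (v : EuclideanSpace ℝ ι) + hP.some ∈ P}) := by
  have hm : MeasurableSet {v : vectorSpan ℝ P | (v : EuclideanSpace ℝ ι) + hP.some ∈ P} :=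
    hPm.preimage (by fun_prop)
  rw [normalizedVolume, dif_pos hP, volume_real_div_covolume_eq b hb hm,
    Module.finrank_eq_card_basis b]

theorem normalizedVolume_image_add_const {Φ : (κ → ℝ) →ₗ[ℝ] EuclideanSpace ℝ ι}
    (hinj : Function.Injective Φ)
    (hΦ : ∀ q, (∀ j, Φ q j ∈ range ((↑) : ℤ → ℝ)) ↔ ∀ i, q i ∈ range ((↑) : ℤ → ℝ))
    (c : EuclideanSpace ℝ ι) {Q : Set (κ → ℝ)} (hQ : (interior Q).Nonempty)
    (hQm : MeasurableSet Q) :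
    normalizedVolume ((fun q => Φ q + c) '' Q) = (Fintype.card κ)! * volume.real Q := by
  set P := (fun q => Φ q + c) '' Q with hP
  have hPne : P.Nonempty := (hQ.mono interior_subset).image _
  have hPm : MeasurableSet P := by
    have hcont : Continuous Φ := Φ.continuous_of_finiteDimensional
    exact ((hcont.add_const c).measurableEmbedding
      ((add_left_injective c).comp hinj)).measurableSet_image.2 hQm
  let Ψ : (κ → ℝ) ≃ₗ[ℝ] vectorSpan ℝ P := (LinearEquiv.ofInjective Φ hinj).trans
    (LinearEquiv.ofEq _ _ (vectorSpan_image_add_const Φ c hQ).symm)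
  have hΨ (q : κ → ℝ) : (Ψ q : EuclideanSpace ℝ ι) = Φ q := rfl
  obtain ⟨q₀, -, hq₀⟩ := hPne.some_mem
  have himage : Ψ.symm '' {v : vectorSpan ℝ P | (v : EuclideanSpace ℝ ι) + hPne.some ∈ P} =
      (fun q => q + q₀) ⁻¹' Q := by
    rw [LinearEquiv.image_eq_preimage_symm]
    ext q
    have htranslate : Φ q + hPne.some = Φ (q + q₀) + c := by
      rw [← hq₀, map_add, add_assoc]
    simp only [mem_preimage, mem_ofPred_eq, LinearEquiv.symm_symm, hΨ, htranslate, hP]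
    exact ((add_left_injective c).comp hinj).mem_set_image
  rw [normalizedVolume_eq_of_basis hPne hPm _ (directionLattice_eq_span Ψ hΦ),
    Module.Basis.equivFun_ofEquivFun, himage, measureReal_def, measure_preimage_add_right,
    measureReal_def]

end NormalizedVolume

/-! ### Volumes of truncated cones -/

theorem setLIntegral_Ici_exp_neg (c : ℝ) :
    ∫⁻ t in Ici c, ENNReal.ofReal (Real.exp (-t)) = ENNReal.ofReal (Real.exp (-c)) := by
  rw [setLIntegral_congr Ioi_ae_eq_Ici.symm,
    ← ofReal_integral_eq_lintegral_ofReal (integrableOn_exp_neg_Ioi c)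
      (Filter.Eventually.of_forall fun t => (Real.exp_pos _).le), integral_exp_neg_Ioi]

theorem setLIntegral_exp_neg_eq_lintegral_measure_le {X : Type*} [MeasurableSpace X]
    (μ : Measure X) [SFinite μ] {C : Set X} (hC : MeasurableSet C) {f : X → ℝ}
    (hf : Measurable f) (hfC : ∀ q ∈ C, 0 ≤ f q) :
    ∫⁻ q in C, ENNReal.ofReal (Real.exp (-f q)) ∂μ =
      ∫⁻ t in Ici 0, ENNReal.ofReal (Real.exp (-t)) * μ (C ∩ {q | f q ≤ t}) := by
  have hlayer : ∀ q ∈ C, ENNReal.ofReal (Real.exp (-f q)) =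
      ∫⁻ t in Ici (0 : ℝ), (Ici (f q)).indicator (fun t => ENNReal.ofReal (Real.exp (-t))) t := by
    intro q hq
    rw [setLIntegral_indicator measurableSet_Ici,
      inter_eq_left.2 (Ici_subset_Ici.2 (hfC q hq)), setLIntegral_Ici_exp_neg]
  have hm : Measurable (Function.uncurry fun q t =>
      (Ici (f q)).indicator (fun t => ENNReal.ofReal (Real.exp (-t))) t) :=
    Measurable.indicator (s := {p : X × ℝ | f p.1 ≤ p.2}) (by fun_prop)
      (measurableSet_le (by fun_prop) (by fun_prop))
  rw [setLIntegral_congr_fun hC hlayer, lintegral_lintegral_swap hm.aemeasurable]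
  refine lintegral_congr fun t => ?_
  have hmt : MeasurableSet {q | f q ≤ t} := measurableSet_le hf measurable_const
  rw [inter_comm, ← Measure.restrict_apply hmt, ← lintegral_indicator_const hmt]
  rfl

open scoped Pointwise in
theorem setLIntegral_exp_neg_of_cone {V : Type*} [NormedAddCommGroup V] [NormedSpace ℝ V]
    [FiniteDimensional ℝ V] [MeasurableSpace V] [BorelSpace V] (μ : Measure V)
    [μ.IsAddHaarMeasure] {C : Set V} (hC : MeasurableSet C)
    (hCsmul : ∀ t : ℝ, 0 < t → ∀ q ∈ C, t • q ∈ C) (ℓ : V →ₗ[ℝ] ℝ) (hℓ : ∀ q ∈ C, 0 ≤ ℓ q) :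
    ∫⁻ q in C, ENNReal.ofReal (Real.exp (-ℓ q)) ∂μ =
      (Module.finrank ℝ V)! * μ (C ∩ {q | ℓ q ≤ 1}) := by
  have hscale : ∀ t ∈ Ioi (0 : ℝ), ENNReal.ofReal (Real.exp (-t)) * μ (C ∩ {q | ℓ q ≤ t}) =
      ENNReal.ofReal (t ^ Module.finrank ℝ V * Real.exp (-t)) * μ (C ∩ {q | ℓ q ≤ 1}) := by
    intro t (ht : 0 < t)
    have hsmul : C ∩ {q | ℓ q ≤ t} = t • (C ∩ {q | ℓ q ≤ 1}) := by
      ext q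
      rw [mem_smul_set_iff_inv_smul_mem₀ ht.ne']
      simp only [mem_inter_iff, mem_ofPred_eq, map_smul, smul_eq_mul]
      rw [inv_mul_le_iff₀ ht, mul_one]
      refine and_congr_left fun _ => ⟨hCsmul _ (inv_pos.2 ht) q, fun h => ?_⟩
      simpa [smul_smul, ht.ne'] using hCsmul t ht _ h
    rw [hsmul, Measure.addHaar_smul, abs_of_pos (by positivity), ← mul_assoc,
      ← ENNReal.ofReal_mul (by positivity), mul_comm (Real.exp _)]
  rw [setLIntegral_exp_neg_eq_lintegral_measure_le μ hC
      ℓ.continuous_of_finiteDimensional.measurable hℓ, setLIntegral_congr Ioi_ae_eq_Ici.symm,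
    setLIntegral_congr_fun measurableSet_Ioi hscale, lintegral_mul_const _ (by fun_prop),
    lintegral_Ioi_pow_mul_exp_neg]

/-! ### The flow polytope of a cone -/

namespace SignedGraph

variable {k : ℕ} {E : Type*} [Fintype E] (G : SignedGraph (Fin k) E)

/-- The flow on the negative edges at the first vertex of the cone over `G` which makes the
netflows at the old vertices vanish. The coordinates are the flow on the edges of `G` (`Sum.inl`)
and on the positive edges at the first vertex (`Sum.inr`). -/
noncomputable def negativeFlow : (E ⊕ Fin k → ℝ) →ₗ[ℝ] Fin k → ℝ :=
  G.netflow ∘ₗ LinearMap.funLeft ℝ ℝ Sum.inl + LinearMap.funLeft ℝ ℝ Sum.inr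

theorem negativeFlow_apply (q : E ⊕ Fin k → ℝ) (v : Fin k) :
    G.negativeFlow q v = G.netflow (fun e => q (.inl e)) v + q (.inr v) :=
  rfl

/-- Half of the total flow on the edges from the first vertex of the cone over `G` to the old
vertices, in the coordinates of `negativeFlow`. -/
noncomputable def apexFlow : (E ⊕ Fin k → ℝ) →ₗ[ℝ] ℝ :=
  (2⁻¹ : ℝ) • ∑ v, (LinearMap.proj (.inr v) + LinearMap.proj v ∘ₗ G.negativeFlow)

theorem two_mul_apexFlow (q : E ⊕ Fin k → ℝ) :
    2 * G.apexFlow q = (∑ v, q (.inr v)) + ∑ v, G.negativeFlow q v := by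
  simp only [apexFlow, LinearMap.smul_apply, LinearMap.sum_apply, LinearMap.add_apply,
    LinearMap.comp_apply, LinearMap.proj_apply, Finset.sum_add_distrib, smul_eq_mul]
  ring

/-- The linear part of the flow on the cone over `G` with netflow `(2, 0, …, 0)`, in the
coordinates of `negativeFlow`. -/
noncomputable def coneFlow : (E ⊕ Fin k → ℝ) →ₗ[ℝ] ApexEdge (Fin k) ⊕ E → ℝ :=
  LinearMap.pi <| Sum.elim
    (fun o => o.elim (-G.apexFlow)
      (Sum.elim (fun v => LinearMap.proj (.inr v)) fun v => LinearMap.proj v ∘ₗ G.negativeFlow))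
    fun e => LinearMap.proj (.inl e)

/-- The flow with one unit on the loop of the cone: the constant part of the flow on the cone over
`G` with netflow `(2, 0, …, 0)`. -/
def loopFlow : ApexEdge (Fin k) ⊕ E → ℝ :=
  Sum.elim (fun o => o.elim 1 fun _ => 0) fun _ => 0

section coneFlow

variable (q : E ⊕ Fin k → ℝ)

@[simp]
theorem coneFlow_loop : G.coneFlow q (.inl none) = -G.apexFlow q :=
  rfl

@[simp]
theorem coneFlow_pos (v : Fin k) : G.coneFlow q (.inl (some (.inl v))) = q (.inr v) :=
  rfl

@[simp]
theorem coneFlow_neg (v : Fin k) :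
    G.coneFlow q (.inl (some (.inr v))) = G.negativeFlow q v :=
  rfl

@[simp]
theorem coneFlow_old (e : E) : G.coneFlow q (.inr e) = q (.inl e) :=
  rfl

end coneFlow

theorem coneFlow_injective : Function.Injective G.coneFlow := by
  intro q q' h
  ext (e | v)
  · exact congrFun h (.inr e)
  · exact congrFun h (.inl (some (.inl v)))

/-- The factor `1 / 2` of `apexFlow` has cancelled, so `apexFlow` is integral at integer points. -/
theorem apexFlow_eq_sum (q : E ⊕ Fin k → ℝ) :
    G.apexFlow q = (∑ v, q (.inr v)) + ∑ e, if G.positive e then q (.inl e) else 0 := by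
  have hnetflow : ∑ v, G.netflow (fun e => q (.inl e)) v =
      2 * ∑ e, if G.positive e then q (.inl e) else 0 := by
    simp_rw [netflow_apply, Finset.mul_sum]
    rw [Finset.sum_comm]
    refine Finset.sum_congr rfl fun e _ => ?_
    rw [← Finset.sum_mul, ← Int.cast_sum, sum_root]
    split_ifs <;> simp
  have htwo := G.two_mul_apexFlow q
  simp_rw [negativeFlow_apply, Finset.sum_add_distrib, hnetflow] at htwo
  linarith

theorem forall_coneFlow_mem_range_intCast_iff (q : E ⊕ Fin k → ℝ) :
    (∀ x, G.coneFlow q x ∈ range ((↑) : ℤ → ℝ)) ↔ ∀ i, q i ∈ range ((↑) : ℤ → ℝ) := by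
  change (∀ x, _ ∈ (Int.castRingHom ℝ).range) ↔ ∀ i, _ ∈ (Int.castRingHom ℝ).range
  constructor
  · rintro h (e | v)
    · exact h (.inr e)
    · exact h (.inl (some (.inl v)))
  · rintro h ((_ | v | v) | e)
    · rw [coneFlow_loop, apexFlow_eq_sum]
      refine neg_mem (add_mem (sum_mem fun v _ => h _) (sum_mem fun e _ => ?_))
      split_ifs
      exacts [h _, zero_mem _]
    · exact h _
    · rw [coneFlow_neg, negativeFlow_apply, netflow_apply]
      exact add_mem (sum_mem fun e _ => mul_mem ⟨_, rfl⟩ (h _)) (h _)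
    · exact h _

theorem netflow_coneFlow_add_loopFlow (q : E ⊕ Fin k → ℝ) :
    G.cone.netflow (G.coneFlow q + loopFlow) =
      fun v => ((Pi.single 0 2 : Fin (k + 1) → ℤ) v : ℝ) := by
  ext v
  cases v using Fin.cases with
  | zero =>
    rw [netflow_cone_zero, Pi.single_eq_same, Int.cast_ofNat]
    simp only [loopFlow, Pi.add_apply, coneFlow_loop, coneFlow_pos, coneFlow_neg, Sum.elim_inl,
      Option.elim, add_zero]
    linarith [G.two_mul_apexFlow q]
  | succ v =>
    rw [netflow_cone_succ]
    simp [loopFlow, negativeFlow_apply]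

theorem exists_coneFlow_add_loopFlow_eq_iff (f : ApexEdge (Fin k) ⊕ E → ℝ) :
    (∃ q, G.coneFlow q + loopFlow = f) ↔
      G.cone.netflow f = fun v => ((Pi.single 0 2 : Fin (k + 1) → ℤ) v : ℝ) := by
  refine ⟨fun ⟨q, hq⟩ => ?_, fun hf => ?_⟩
  · rw [← hq]
    exact G.netflow_coneFlow_add_loopFlow q
  set q : E ⊕ Fin k → ℝ := Sum.elim (fun e => f (.inr e)) fun v => f (.inl (some (.inl v)))
  have hneg (v : Fin k) : G.negativeFlow q v = f (.inl (some (.inr v))) := by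
    have hsucc := congrFun hf v.succ
    rw [netflow_cone_succ, Pi.single_eq_of_ne v.succ_ne_zero, Int.cast_zero, sub_eq_zero] at hsucc
    exact hsucc
  have hloop : 2 * f (.inl none) + 2 * G.apexFlow q = 2 := by
    have hzero := congrFun hf 0
    rw [netflow_cone_zero, Pi.single_eq_same, Int.cast_ofNat] at hzero
    simp_rw [two_mul_apexFlow, hneg]
    exact hzero
  refine ⟨q, ?_⟩
  ext ((_ | v | v) | e)
  · rw [Pi.add_apply, coneFlow_loop, show loopFlow (.inl none) = (1 : ℝ) from rfl]
    linarith
  · simp [q, loopFlow]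
  · simp [hneg, loopFlow]
  · simp [q, loopFlow]

/-- The values of the coordinates for which all flows on the cone over `G`, except possibly the
flow on the loop, are nonnegative. -/
def flowCone : Set (E ⊕ Fin k → ℝ) :=
  {q | (∀ i, 0 ≤ q i) ∧ ∀ v, 0 ≤ G.negativeFlow q v}

theorem coneFlow_add_loopFlow_nonneg_iff (q : E ⊕ Fin k → ℝ) :
    (∀ x, 0 ≤ G.coneFlow q x + loopFlow x) ↔
      q ∈ G.flowCone ∩ {q | G.apexFlow q ≤ 1} := by
  simp only [Sum.forall, Option.forall, coneFlow_loop, coneFlow_pos, coneFlow_neg,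
    coneFlow_old, loopFlow, Sum.elim_inl, Sum.elim_inr, Option.elim, add_zero,
    le_neg_add_iff_add_le, flowCone, mem_inter_iff, mem_ofPred_eq]
  tauto

theorem apexFlow_nonneg {q : E ⊕ Fin k → ℝ} (hq : q ∈ G.flowCone) : 0 ≤ G.apexFlow q := by
  linarith [G.two_mul_apexFlow q, Finset.univ.sum_nonneg fun v _ => hq.1 (.inr v),
    Finset.univ.sum_nonneg fun v _ => hq.2 v]

theorem smul_mem_flowCone {t : ℝ} (ht : 0 < t) {q : E ⊕ Fin k → ℝ} (hq : q ∈ G.flowCone) :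
    t • q ∈ G.flowCone := by
  refine ⟨fun i => mul_nonneg ht.le (hq.1 i), fun v => ?_⟩
  rw [map_smul]
  exact mul_nonneg ht.le (hq.2 v)

@[fun_prop]
theorem continuous_negativeFlow : Continuous G.negativeFlow :=
  G.negativeFlow.continuous_of_finiteDimensional

@[fun_prop]
theorem continuous_apexFlow : Continuous G.apexFlow :=
  G.apexFlow.continuous_of_finiteDimensional

theorem measurableSet_flowCone : MeasurableSet G.flowCone := by
  refine IsClosed.measurableSet ?_
  simp only [flowCone, ofPred_and, ofPred_forall]
  exact (isClosed_iInter fun i => isClosed_le (by fun_prop) (by fun_prop)).inter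
    (isClosed_iInter fun v => isClosed_le (by fun_prop) (by fun_prop))

theorem mem_interior_flowCone_inter {q : E ⊕ Fin k → ℝ} (hq : ∀ i, 0 < q i)
    (hneg : ∀ v, 0 < G.negativeFlow q v) (hapex : G.apexFlow q < 1) :
    q ∈ interior (G.flowCone ∩ {q | G.apexFlow q ≤ 1}) := by
  have hq' : ∀ᶠ p in nhds q, ∀ i, 0 < p i := Filter.eventually_all.2 fun i =>
    continuousAt_const.eventually_lt (continuousAt_apply i q) (hq i)
  have hneg' : ∀ᶠ p in nhds q, ∀ v, 0 < G.negativeFlow p v := Filter.eventually_all.2 fun v =>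
    continuousAt_const.eventually_lt (by fun_prop) (hneg v)
  have hapex' : ∀ᶠ p in nhds q, G.apexFlow p < 1 :=
    G.continuous_apexFlow.continuousAt.eventually_lt continuousAt_const hapex
  refine mem_interior_iff_mem_nhds.2 ?_
  filter_upwards [hq', hneg', hapex'] with p hp hpneg hpapex
  exact ⟨⟨fun i => (hp i).le, fun v => (hpneg v).le⟩, hpapex.le⟩

theorem interior_flowCone_inter_nonempty :
    (interior (G.flowCone ∩ {q | G.apexFlow q ≤ 1})).Nonempty := by
  let r : E ⊕ Fin k → ℝ := Sum.elim (fun _ => 1) fun v => 1 + |G.netflow (fun _ => 1) v|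
  have hr (i : E ⊕ Fin k) : 0 < r i := by
    rcases i with e | v <;> simp only [r, Sum.elim_inl, Sum.elim_inr] <;> positivity
  have hneg (v : Fin k) : 0 < G.negativeFlow r v := by
    simp only [negativeFlow_apply, r, Sum.elim_inl, Sum.elim_inr]
    linarith [neg_abs_le (G.netflow (fun _ => 1) v)]
  have hapex := G.apexFlow_nonneg ⟨fun i => (hr i).le, fun v => (hneg v).le⟩
  have ht : 0 < (1 + G.apexFlow r)⁻¹ := by positivity
  refine ⟨(1 + G.apexFlow r)⁻¹ • r, G.mem_interior_flowCone_inter (fun i => mul_pos ht (hr i))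
    (fun v => ?_) ?_⟩
  · rw [map_smul]
    exact mul_pos ht (hneg v)
  · rw [map_smul, smul_eq_mul, inv_mul_lt_iff₀ (by positivity)]
    linarith

theorem indicator_flowCone_exp_neg_apexFlow {q : E ⊕ Fin k → ℝ} (hq : ∀ i, 0 ≤ q i) :
    G.flowCone.indicator (fun q => ENNReal.ofReal (Real.exp (-G.apexFlow q))) q =
      ∏ v, gammaKernel 0 (q (.inr v)) *
        gammaKernel 0 (q (.inr v) + G.netflow (fun e => q (.inl e)) v) := by
  simp_rw [add_comm (q _), ← negativeFlow_apply]
  by_cases hneg : ∀ v, 0 ≤ G.negativeFlow q v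
  · have hexp : Real.exp (-G.apexFlow q) =
        ∏ v, Real.exp (-q (.inr v) / 2) * Real.exp (-G.negativeFlow q v / 2) := by
      simp_rw [← Real.exp_add, ← Real.exp_sum, ← add_div, ← Finset.sum_div,
        Finset.sum_add_distrib, Finset.sum_neg_distrib]
      congr 1
      linarith [G.two_mul_apexFlow q]
    rw [indicator_of_mem (show q ∈ G.flowCone from ⟨hq, hneg⟩), hexp,
      ENNReal.ofReal_prod_of_nonneg fun v _ => by positivity]
    simp_rw [gammaKernel_of_nonneg _ (hq _), gammaKernel_of_nonneg _ (hneg _),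
      ENNReal.ofReal_mul (Real.exp_pos _).le]
    simp
  · rw [indicator_of_notMem fun hmem => hneg hmem.2]
    push Not at hneg
    obtain ⟨v, hv⟩ := hneg
    refine (Finset.prod_eq_zero (Finset.mem_univ v) ?_).symm
    rw [gammaKernel_of_neg _ hv, mul_zero]

theorem setLIntegral_flowCone_exp_neg_apexFlow :
    ∫⁻ q in G.flowCone, ENNReal.ofReal (Real.exp (-G.apexFlow q)) =
      flowIntegral G (fun _ => 0) fun _ => 0 := by
  have hsub : G.flowCone ⊆ {q | ∀ i, 0 ≤ q i} := fun q hq => hq.1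
  rw [← Measure.restrict_restrict_of_subset hsub, ← orthantMeasure_eq_restrict,
    ← lintegral_indicator G.measurableSet_flowCone,
    lintegral_congr_ae ((ae_orthantMeasure_nonneg _).mono fun q hq =>
      G.indicator_flowCone_exp_neg_apexFlow hq), orthantMeasure, lintegral_pi_sum _ (by fun_prop),
    flowIntegral, orthantMeasure]
  refine lintegral_congr fun f => ?_
  simp only [Sum.elim_inl, Sum.elim_inr]
  rw [lintegral_pi_prod _ (g := fun v p => gammaKernel 0 p * gammaKernel 0 (p + G.netflow f v))
    (by fun_prop)]
  simp_rw [setLIntegral_Ici_gammaKernel_mul, twoSidedKernel]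

variable {E' : Type*} (e : ApexEdge (Fin k) ⊕ E ≃ E')

/-- `coneFlow`, relabelled by `e` and as a map to a Euclidean space. -/
noncomputable def relabelledConeFlow : (E ⊕ Fin k → ℝ) →ₗ[ℝ] EuclideanSpace ℝ E' :=
  (WithLp.linearEquiv 2 ℝ (E' → ℝ)).symm.toLinearMap ∘ₗ LinearMap.funLeft ℝ ℝ e.symm ∘ₗ G.coneFlow

theorem relabelledConeFlow_apply (q : E ⊕ Fin k → ℝ) (x : ApexEdge (Fin k) ⊕ E) :
    G.relabelledConeFlow e q (e x) = G.coneFlow q x := by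
  simp [relabelledConeFlow, LinearMap.funLeft_apply]

theorem relabelledConeFlow_add_comp (q : E ⊕ Fin k → ℝ) :
    (G.relabelledConeFlow e q + WithLp.toLp 2 (loopFlow ∘ e.symm)).ofLp ∘ e =
      G.coneFlow q + loopFlow := by
  ext x
  simp [relabelledConeFlow_apply]

variable {G} [Fintype E'] {H : SignedGraph (Fin (k + 1)) E'}

theorem flowPolytope_single_two_eq_image (he : ∀ x, H.root (e x) = G.cone.root x) :
    H.flowPolytope (Pi.single 0 2) =
      (fun q => G.relabelledConeFlow e q + WithLp.toLp 2 (loopFlow ∘ e.symm)) ''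
        (G.flowCone ∩ {q | G.apexFlow q ≤ 1}) := by
  ext f
  have hpoint (q : E ⊕ Fin k → ℝ) :
      G.relabelledConeFlow e q + WithLp.toLp 2 (loopFlow ∘ e.symm) = f ↔
        G.coneFlow q + loopFlow = f.ofLp ∘ e := by
    rw [← G.relabelledConeFlow_add_comp e, e.surjective.injective_comp_right.eq_iff]
    exact (WithLp.ofLp_injective 2).eq_iff.symm
  rw [mem_flowPolytope_iff, ← netflow_comp_equiv e he, ← exists_coneFlow_add_loopFlow_eq_iff,
    e.symm.forall_congr_left]
  simp_rw [mem_image, hpoint, ← coneFlow_add_loopFlow_nonneg_iff]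
  constructor
  · rintro ⟨hf, q, hq⟩
    exact ⟨q, fun x => (hf x).trans_eq (congrFun hq x).symm, hq⟩
  · rintro ⟨q, hf, hq⟩
    exact ⟨fun x => (hf x).trans_eq (congrFun hq x), q, hq⟩

theorem normalizedVolume_flowPolytope_single_two (he : ∀ x, H.root (e x) = G.cone.root x) :
    normalizedVolume (H.flowPolytope (Pi.single 0 2)) =
      (flowIntegral G (fun _ => 0) fun _ => 0).toReal := by
  have hinj : Function.Injective (G.relabelledConeFlow e) :=
    (WithLp.linearEquiv 2 ℝ (E' → ℝ)).symm.injective.comp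
      (e.symm.surjective.injective_comp_right.comp G.coneFlow_injective)
  have hint (q : E ⊕ Fin k → ℝ) : (∀ j, G.relabelledConeFlow e q j ∈ range ((↑) : ℤ → ℝ)) ↔
      ∀ i, q i ∈ range ((↑) : ℤ → ℝ) := by
    rw [← G.forall_coneFlow_mem_range_intCast_iff, e.symm.forall_congr_left]
    simp_rw [e.symm_symm, relabelledConeFlow_apply]
  rw [flowPolytope_single_two_eq_image e he, normalizedVolume_image_add_const hinj hint _
      G.interior_flowCone_inter_nonempty
      (G.measurableSet_flowCone.inter (measurableSet_le (by fun_prop) measurable_const)),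
    ← setLIntegral_flowCone_exp_neg_apexFlow,
    setLIntegral_exp_neg_of_cone volume G.measurableSet_flowCone
      (fun t ht q hq => G.smul_mem_flowCone ht hq) G.apexFlow fun q hq => G.apexFlow_nonneg hq,
    ENNReal.toReal_mul, ENNReal.toReal_natCast, Module.finrank_fintype_fun_eq_card, measureReal_def]

end SignedGraph

theorem normalizedVolume_CRYC (n : ℕ) :
    normalizedVolume (CRYC n) = flowCount n (fun _ => 0) fun _ => 0 := by
  rw [CRYC, normalizedVolume_flowPolytope_single_two _ (root_completeCEdgeEquiv n),
    flowIntegral_completeC, ENNReal.toReal_natCast]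

theorem flowCount_succ_zero (k : ℕ) :
    flowCount (k + 1) (fun _ => 0) (fun _ => 0) = flowCount k (fun _ => 1) fun _ => 1 := by
  simp [flowCount]

theorem mainTheorem3 (n : ℕ) :
    algebraMap ℝ (RatFun (Fin (n - 1))) (normalizedVolume (CRYC n)) =
      RatFun.iteratedCT
        ((∏ i : Fin (n - 1),
            (RatFun.x i)⁻¹ * ((1 - RatFun.x i) ^ 2)⁻¹ * (1 - 2 * RatFun.x i)⁻¹) *
          ∏ i : Fin (n - 1), ∏ j ∈ Finset.Ioi i,
            (RatFun.x j - RatFun.x i)⁻¹ * (1 - RatFun.x j - RatFun.x i)⁻¹) := by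
  have hcount : flowCount n (fun _ => 0) (fun _ => 0) =
      flowCount (n - 1) (fun _ => 1) (fun _ => 1) := by
    cases n with
    | zero => rfl
    | succ n => exact flowCount_succ_zero n
  rw [normalizedVolume_CRYC, hcount, map_natCast, ← RatFun.iteratedCT_kernelProduct,
    RatFun.kernelProduct]
  simp only [pow_one, one_add_one_eq_two]
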